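/- Let $K$ be a field with $\operatorname{char} K \neq 2$, let $F$ be the free group on a countably infinite alphabet, and let $KF$ be its group algebra. An element $u = u(x_1,\dots,x_n) \in KF$ is an identity of a representation $\rho : G \to \operatorname{Aut}_K V$ of a group $G$ over $K$ if for all $g_1,\dots,g_n \in G$ the element $u(g_1,\dots,g_n) \in KG$ annihilates $V$. A set $U$ of identities of $\rho$ is a basis of identities of $\rho$ if the representations of groups over $K$ that satisfy all identities in $U$ are exactly those that satisfy all identities of $\rho$. Write $x^y = y^{-1}xy$ and $x^{2y} = (x^2)^y$. Then the following three elements of $KF$, in which distinct symbols within one element denote distinct letters of the alphabet, form a basis of identities of the regular representation $\operatorname{Reg}_K D_8 = (KD_8, D_8)$ of the dihedral group $D_8$ of order $8$: $$\prod_{0 \le i < j \le 8} \bigl((x_i x_j^{-1})^{y_{ij}} - 1\bigr),$$ $$x^4 - 1,$$ $$(x_1^{2y_1} - 1)(x_2^{2y_2} - 1)(x_3^{2y_3} - 1)\bigl((x_1x_2^{-1})^{y_4} - 1\bigr)\bigl((x_1x_3^{-1})^{y_5} - 1\bigr)\bigl((x_2x_3^{-1})^{y_6} - 1\bigr).$$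 Here the factors of the first product may be multiplied in any fixed order. -/

import Mathlib

/-! Identities of group representations over a field. -/

universe uK uH uW uG uV

namespace RepIdentities

/-- The free group `F` on the countable alphabet `X 0, X 1, X 2, …`. -/
abbrev F : Type := FreeGroup ℕ

/-- The `n`-th letter of the alphabet. -/
abbrev X (n : ℕ) : F := FreeGroup.of n

/-- `u(g₀, g₁, …) ∈ KG`: the image of `u ∈ KF` under the algebra homomorphism `KF → KG` which
extends the group homomorphism `F → G` sending the `i`-th letter to `g i`. -/
noncomputable def subst {K G : Type*} [Field K] [Group G] (g : ℕ → G)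
    (u : MonoidAlgebra K F) : MonoidAlgebra K G :=
  MonoidAlgebra.mapDomainAlgHom K K (FreeGroup.lift g) u

/-- `u ∈ KF` is an identity of the representation `ρ = (V, G)` if for all elements `g i` of `G`
the element `u(g₀, g₁, …)` of `KG` annihilates `V`. -/
def IsIdentity {K G V : Type*} [Field K] [Group G] [AddCommGroup V] [Module K V]
    (ρ : Representation K G V) (u : MonoidAlgebra K F) : Prop :=
  ∀ (g : ℕ → G) (v : V), ρ.asAlgebraHom (subst g u) v = 0

/-- Membership of `σ` in the variety of group representations defined by the set `U ⊆ KF`. -/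
def InVarietyDefinedBy {K G V : Type*} [Field K] [Group G] [AddCommGroup V] [Module K V]
    (U : Set (MonoidAlgebra K F)) (σ : Representation K G V) : Prop :=
  ∀ u ∈ U, IsIdentity σ u

/-- The set of all identities of `ρ`; the variety generated by `ρ` is the one it defines. -/
def identitiesOf {K G V : Type*} [Field K] [Group G] [AddCommGroup V] [Module K V]
    (ρ : Representation K G V) : Set (MonoidAlgebra K F) :=
  {u | IsIdentity ρ u}

/-- `U` is a basis of identities of `ρ`: the elements of `U` are identities of `ρ`, and the
variety of group representations over `K` defined by `U` is the variety generated by `ρ`. -/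
def IsBasisOfIdentities {K : Type uK} {H : Type uH} {W : Type uW} [Field K] [Group H]
    [AddCommGroup W] [Module K W] (ρ : Representation K H W)
    (U : Set (MonoidAlgebra K F)) : Prop :=
  U ⊆ identitiesOf ρ ∧
    ∀ (G : Type uG) (V : Type uV) [Group G] [AddCommGroup V] [Module K V]
      (σ : Representation K G V),
      InVarietyDefinedBy U σ ↔ InVarietyDefinedBy (identitiesOf ρ) σ

/-- The conjugate `x ^ y = y⁻¹ x y`. -/
def conjBy (x y : F) : F := y⁻¹ * x * y

/-- The element `w - 1` of `KF`, for a word `w ∈ F`. -/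
noncomputable def minusOne (K : Type*) [Field K] (w : F) : MonoidAlgebra K F :=
  MonoidAlgebra.of K F w - 1

/-- The product of the `(xᵢ xⱼ⁻¹)^{yᵢⱼ} - 1` over the pairs `(i, j)` in the list `l`, in the order
of the list. Here `xᵢ` is the letter number `i ≤ 8` and `yᵢⱼ` the letter number `9 + 9 i + j`. -/
noncomputable def omegaStar (K : Type*) [Field K] (l : List (Fin 9 × Fin 9)) :
    MonoidAlgebra K F :=
  (l.map fun p => minusOne K
    (conjBy (X p.1 * (X p.2)⁻¹) (X (9 + 9 * (p.1 : ℕ) + (p.2 : ℕ))))).prod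

/-- The element `x⁴ - 1`. -/
noncomputable def expStar (K : Type*) [Field K] : MonoidAlgebra K F :=
  minusOne K (X 0 ^ 4)

/-- The element
`(x₁^{2y₁} - 1)(x₂^{2y₂} - 1)(x₃^{2y₃} - 1)((x₁x₂⁻¹)^{y₄} - 1)((x₁x₃⁻¹)^{y₅} - 1)((x₂x₃⁻¹)^{y₆} - 1)`,
where `x₁, x₂, x₃` are the letters number `1, 2, 3` and `y₁, …, y₆` the letters number
`4, …, 9`. -/
noncomputable def threeStar (K : Type*) [Field K] : MonoidAlgebra K F :=
  minusOne K (conjBy (X 1 ^ 2) (X 4)) *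
  minusOne K (conjBy (X 2 ^ 2) (X 5)) *
  minusOne K (conjBy (X 3 ^ 2) (X 6)) *
  minusOne K (conjBy (X 1 * (X 2)⁻¹) (X 7)) *
  minusOne K (conjBy (X 1 * (X 3)⁻¹) (X 8)) *
  minusOne K (conjBy (X 2 * (X 3)⁻¹) (X 9))

end RepIdentities

/-! The annihilator of a simple module is prime. So if a product of independently conjugated factors
`g - 1` kills a simple module, some `g` acts trivially on it. The three identities therefore force
the group `Q` acting faithfully on a simple module to have at most eight elements, exponent dividing
4 and at most two elements with nontrivial square. Central involutions of `Q` act as -1, so there is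
at most one. Such a `Q` embeds in D₈ (`exists_injective_dihedralGroup`), hence all identities of the
regular representation hold in these simple modules (`annihilates_of_isSimpleModule`).

For a general module `V`, let `n` be killed by every homomorphism to D₈. It acts trivially on the
simple modules just described; as 4 is invertible, this makes `1 + n + n² + n³` act injectively on
`V`, and `n⁴ = 1` there gives `n = 1` on `V` (`smul_eq_of_forall_hom_eq_one`). An identity involves
finitely many letters, so the group may be taken free of finite rank. It has finitely many
homomorphisms to D₈, so it acts through a finite 2-group; since char K ≠ 2, Maschke's theorem
reduces to simple modules.

Conversely, for every substitution from D₈, each of the two product identities has a zero factor. -/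

namespace RepIdentities

/-! ### Recognizing subgroups of D₈ -/

section Group

/-- A cyclic group of order dividing `4` embeds in the dihedral group of order `8`. -/
theorem exists_injective_dihedralGroup_of_isCyclic {Q : Type*} [Group Q] [IsCyclic Q]
    (hQ : Nat.card Q ∣ 4) :
    ∃ e : Q →* DihedralGroup 4, Function.Injective e := by
  obtain ⟨d, hd⟩ := hQ
  have hd0 : d ≠ 0 := by rintro rfl; simp at hd
  -- Here `d` is 4 / |Q|, so the `d`-th power of the rotation has order |Q|.
  have hcard : Nat.card Q =
      Nat.card (Subgroup.zpowers ((DihedralGroup.r 1 : DihedralGroup 4) ^ d)) := by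
    rw [Nat.card_zpowers, orderOf_pow_of_dvd hd0
      (by rw [DihedralGroup.orderOf_r_one]; exact ⟨_, hd.trans (mul_comm _ _)⟩),
      DihedralGroup.orderOf_r_one, hd, Nat.mul_div_cancel _ (Nat.pos_of_ne_zero hd0)]
  let e := mulEquivOfCyclicCardEq hcard
  exact ⟨(Subgroup.subtype _).comp e.toMonoidHom,
    Subtype.val_injective.comp e.injective⟩

/-- A group in which every square is trivial and which has at most one central involution embeds
in the dihedral group of order `8`. -/
theorem exists_injective_dihedralGroup_of_sq_eq_one {Q : Type*} [Group Q]
    (h2 : ∀ x : Q, x ^ 2 = 1)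
    (hc : ∀ x ∈ Subgroup.center Q, ∀ y ∈ Subgroup.center Q,
      x ^ 2 = 1 → y ^ 2 = 1 → x ≠ 1 → y ≠ 1 → x = y) :
    ∃ e : Q →* DihedralGroup 4, Function.Injective e := by
  have hinv : ∀ x : Q, x⁻¹ = x := fun x =>
    inv_eq_of_mul_eq_one_left (by rw [← pow_two, h2])
  have hcomm : ∀ x y : Q, x * y = y * x := fun x y => by
    rw [← hinv (x * y), mul_inv_rev, hinv, hinv]
  have hcent : ∀ x : Q, x ∈ Subgroup.center Q := fun x =>
    Subgroup.mem_center_iff.2 fun y => hcomm y x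
  -- All nontrivial elements are central involutions, so there is at most one.
  have huniq : ∀ x y : Q, x ≠ 1 → y ≠ 1 → x = y := fun x y =>
    hc x (hcent x) y (hcent y) (h2 x) (h2 y)
  by_cases ht : ∃ t : Q, t ≠ 1
  · obtain ⟨t, ht⟩ := ht
    have hgen : ∀ x : Q, x ∈ Subgroup.zpowers t := fun x => by
      by_cases hx : x = 1
      · exact hx ▸ one_mem _
      · exact huniq t x ht hx ▸ Subgroup.mem_zpowers t
    have : IsCyclic Q := ⟨t, hgen⟩
    apply exists_injective_dihedralGroup_of_isCyclic
    rw [← orderOf_eq_card_of_forall_mem_zpowers hgen]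
    exact (orderOf_dvd_of_pow_eq_one (h2 t)).trans (by norm_num)
  · push Not at ht
    exact ⟨1, fun x y _ => by rw [ht x, ht y]⟩

/-- The homomorphism from the dihedral group of order `8` given by two elements satisfying its
defining relations. -/
def dihedralLift {Q : Type*} [Group Q] (a s : Q) (ha : a ^ 4 = 1) (hs : s ^ 2 = 1)
    (has : a * s = s * a⁻¹) : DihedralGroup 4 →* Q where
  toFun
    | .r i => a ^ i.val
    | .sr i => s * a ^ i.val
  map_one' := by
    change a ^ (0 : ZMod 4).val = 1
    simp
  map_mul' := by
    have hadd : ∀ i j : ZMod 4, a ^ (i + j).val = a ^ i.val * a ^ j.val := fun i j => by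
      rw [ZMod.val_add, ← pow_add]
      exact (pow_eq_pow_mod _ ha).symm
    have hneg : ∀ i : ZMod 4, a ^ (-i).val = (a ^ i.val)⁻¹ := fun i => by
      rw [eq_inv_iff_mul_eq_one, ← hadd]; simp
    have hsub : ∀ i j : ZMod 4, a ^ (j - i).val = (a ^ i.val)⁻¹ * a ^ j.val := fun i j => by
      rw [sub_eq_neg_add, hadd, hneg]
    have hswap : ∀ n : ℕ, a ^ n * s = s * (a ^ n)⁻¹ := fun n => by
      have : SemiconjBy s a⁻¹ a := has.symm
      rw [← inv_pow]
      exact (this.pow_right n).symm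
    have hss : s * s = 1 := by rw [← pow_two, hs]
    rintro (i | i) (j | j)
    · change a ^ (i + j).val = _
      exact hadd i j
    · change s * a ^ (j - i).val = a ^ i.val * (s * a ^ j.val)
      rw [hsub, ← mul_assoc, ← mul_assoc, hswap]
    · change s * a ^ (i + j).val = s * a ^ i.val * a ^ j.val
      rw [hadd, mul_assoc]
    · change a ^ (j - i).val = s * a ^ i.val * (s * a ^ j.val)
      rw [hsub, mul_assoc s, ← mul_assoc (a ^ i.val), hswap, ← mul_assoc, ← mul_assoc, hss,
        one_mul]

/-- A group of order at most `8` and exponent dividing `4` with at most two elements of order `4`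
and at most one central involution embeds in the dihedral group of order `8`. -/
theorem exists_injective_dihedralGroup {Q : Type*} [Group Q]
    (h9 : ∀ q : Fin 9 → Q, ∃ i j, i < j ∧ q i = q j)
    (h4 : ∀ x : Q, x ^ 4 = 1)
    (h3 : ∀ x y z : Q, x ^ 2 = 1 ∨ y ^ 2 = 1 ∨ z ^ 2 = 1 ∨ x = y ∨ x = z ∨ y = z)
    (hc : ∀ x ∈ Subgroup.center Q, ∀ y ∈ Subgroup.center Q,
      x ^ 2 = 1 → y ^ 2 = 1 → x ≠ 1 → y ≠ 1 → x = y) :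
    ∃ e : Q →* DihedralGroup 4, Function.Injective e := by
  by_cases h2 : ∀ x : Q, x ^ 2 = 1
  · exact exists_injective_dihedralGroup_of_sq_eq_one h2 hc
  push Not at h2
  obtain ⟨a, ha⟩ := h2
  have hord : orderOf a = 4 := orderOf_eq_prime_pow (p := 2) (n := 1) (by simpa using ha)
    (by simpa using h4 a)
  by_cases hgen : ∀ x, x ∈ Subgroup.zpowers a
  · have : IsCyclic Q := ⟨a, hgen⟩
    apply exists_injective_dihedralGroup_of_isCyclic
    rw [← orderOf_eq_card_of_forall_mem_zpowers hgen, hord]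
  push Not at hgen
  obtain ⟨s, hs⟩ := hgen
  have hainv : a ≠ a⁻¹ := fun h => ha (by rw [pow_two]; nth_rw 2 [h]; simp)
  -- The elements `a` and `a⁻¹` already exhaust the two allowed elements of order 4.
  have hsq : ∀ x, x ∉ Subgroup.zpowers a → x ^ 2 = 1 := fun x hx => by
    rcases h3 a a⁻¹ x with h | h | h | h | h | h
    · exact absurd h ha
    · exact absurd (by simpa using h) ha
    · exact h
    · exact absurd h hainv
    · exact absurd (h ▸ Subgroup.mem_zpowers a) hx
    · exact absurd (h ▸ inv_mem (Subgroup.mem_zpowers a)) hx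
  have hs2 := hsq s hs
  have hsa := hsq (a * s) fun h => hs ((Subgroup.mul_mem_cancel_left _
    (Subgroup.mem_zpowers a)).1 h)
  have has : a * s = s * a⁻¹ := by
    rw [pow_two, mul_eq_one_iff_eq_inv, mul_inv_rev] at hsa
    rw [hsa, inv_eq_of_mul_eq_one_left (by rw [← pow_two, hs2] : s * s = 1)]
  let f := dihedralLift a s (h4 a) hs2 has
  have hpow : ∀ i : ZMod 4, a ^ i.val ∈ Subgroup.zpowers a := fun i =>
    Subgroup.npow_mem_zpowers a _
  have hval : ∀ i j : ZMod 4, a ^ i.val = a ^ j.val → i = j := fun i j hij => by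
    apply ZMod.val_injective
    exact pow_injOn_Iio_orderOf (by simpa [hord] using ZMod.val_lt i)
      (by simpa [hord] using ZMod.val_lt j) hij
  have hinj : Function.Injective f := by
    rintro (i | i) (j | j) hij
    · exact congrArg _ (hval i j hij)
    · change a ^ i.val = s * a ^ j.val at hij
      exact absurd ((Subgroup.mul_mem_cancel_right _ (hpow j)).1 (hij ▸ hpow i)) hs
    · change s * a ^ i.val = a ^ j.val at hij
      exact absurd ((Subgroup.mul_mem_cancel_right _ (hpow i)).1 (hij ▸ hpow j)) hs
    · exact congrArg _ (hval i j (mul_left_cancel (a := s) hij))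
  -- An element outside the image, together with the eight in it, would give nine distinct elements.
  have hsurj : Function.Surjective f := by
    intro x
    by_contra hx
    push Not at hx
    have e : Fin 8 ≃ DihedralGroup 4 := (Fintype.equivFinOfCardEq (by
      rw [DihedralGroup.card])).symm
    have hinj' : Function.Injective (Fin.cons x (f ∘ e) : Fin 9 → Q) :=
      Fin.cons_injective_iff.2 ⟨by rintro ⟨i, hi⟩; exact hx _ hi, hinj.comp e.injective⟩
    obtain ⟨i, j, hij, h⟩ := h9 (Fin.cons x (f ∘ e))
    exact hij.ne (hinj' h)
  let E := MulEquiv.ofBijective f ⟨hinj, hsurj⟩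
  exact ⟨E.symm.toMonoidHom, E.symm.injective⟩

end Group

/-! ### Primeness of annihilators and values of the identities -/

section Module

variable {K : Type*} [Field K] {G : Type*} [Group G]

/-- If the kernel of `f : G →* H` acts trivially on a `K[G]`-module, then so does everything in
the kernel of `K[G] → K[H]`. -/
theorem smul_eq_zero_of_mapDomain_eq_zero {H M : Type*} [Group H] [AddCommGroup M]
    [Module (MonoidAlgebra K G) M] (f : G →* H)
    (hf : ∀ g, f g = 1 → ∀ m : M, MonoidAlgebra.of K G g • m = m)
    {w : MonoidAlgebra K G} (hw : MonoidAlgebra.mapDomainAlgHom K K f w = 0) (m : M) :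
    w • m = 0 := by
  classical
  -- The orbit map of `m` factors through the image of `f`; the value 0 off the image is arbitrary.
  -- Its linear extension `T` then recovers `w ↦ w • m` from the image of `w`.
  let θ : H → M := Function.extend f (fun g => MonoidAlgebra.of K G g • m) fun _ => 0
  have hθ : ∀ g, θ (f g) = MonoidAlgebra.of K G g • m := by
    refine Function.FactorsThrough.extend_apply ?_ fun _ => 0
    intro g h hgh
    have h1 := hf (h⁻¹ * g) (by rw [map_mul, map_inv, hgh, inv_mul_cancel]) m
    change MonoidAlgebra.of K G g • m = MonoidAlgebra.of K G h • m
    conv_rhs => rw [← h1, smul_smul, ← map_mul, mul_inv_cancel_left]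
  let T : MonoidAlgebra K H →+ M :=
    (Finsupp.liftAddHom fun h =>
      ((smulAddHom (MonoidAlgebra K G) M).flip (θ h)).comp
        (algebraMap K (MonoidAlgebra K G)).toAddMonoidHom).comp
      MonoidAlgebra.coeffAddEquiv.toAddMonoidHom
  have hT : ∀ h c, T (MonoidAlgebra.single h c) = algebraMap K (MonoidAlgebra K G) c • θ h := by
    intro h c
    simp [T]
  have key : (T.comp (MonoidAlgebra.mapDomainAlgHom K K f).toRingHom.toAddMonoidHom) =
      (smulAddHom (MonoidAlgebra K G) M).flip m := by
    refine MonoidAlgebra.addMonoidHom_ext fun g c => ?_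
    change T (MonoidAlgebra.mapDomain f (MonoidAlgebra.single g c)) =
      MonoidAlgebra.single g c • m
    rw [MonoidAlgebra.mapDomain_single, hT, hθ, smul_smul]
    congr 1
    simp
  have := DFunLike.congr_fun key w
  change T (MonoidAlgebra.mapDomainAlgHom K K f w) = w • m at this
  rw [← this, hw, map_zero]

/-- The annihilator of a simple `K[G]`-module is a prime ideal. -/
theorem annihilates_or_annihilates {M : Type*} [AddCommGroup M] [Module (MonoidAlgebra K G) M]
    [IsSimpleModule (MonoidAlgebra K G) M] {a b : MonoidAlgebra K G}
    (h : ∀ (y : G) (m : M), (a * MonoidAlgebra.of K G y * b) • m = 0) :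
    (∀ m : M, a • m = 0) ∨ ∀ m : M, b • m = 0 := by
  by_contra! hcon
  obtain ⟨⟨m, hm⟩, ⟨n, hn⟩⟩ := hcon
  -- By simplicity the nonzero vector `b • n` generates `M`, so it suffices that `a` kills every `r
  -- • b • n`.
  obtain ⟨r, hr⟩ := IsSimpleModule.toSpanSingleton_surjective (MonoidAlgebra K G) hn m
  rw [LinearMap.toSpanSingleton_apply] at hr
  apply hm
  rw [← hr]
  have : ∀ r : MonoidAlgebra K G, a • r • b • n = 0 := fun r => by
    induction r using MonoidAlgebra.induction_on with
    | of y => simpa [mul_smul] using h y n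
    | add x y hx hy => rw [add_smul, smul_add, hx, hy, add_zero]
    | smul c x hx =>
      rw [Algebra.smul_def, mul_smul, smul_smul, ← Algebra.commutes, mul_smul, hx, smul_zero]
  exact this r

/-- The conjugate of an element of the group algebra by a group element. -/
noncomputable def conjAlg (a : MonoidAlgebra K G) (y : G) : MonoidAlgebra K G :=
  MonoidAlgebra.of K G y⁻¹ * a * MonoidAlgebra.of K G y

/-- If all products of independent conjugates of the elements `a i` annihilate a simple module,
then one of the `a i` does. -/
theorem exists_annihilates_of_prod_conj {M : Type*} [AddCommGroup M]
    [Module (MonoidAlgebra K G) M] [IsSimpleModule (MonoidAlgebra K G) M] {ι : Type*}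
    (a : ι → MonoidAlgebra K G) (l : List ι) (hl : l.Nodup)
    (h : ∀ (y : ι → G) (m : M), (l.map fun i => conjAlg (a i) (y i)).prod • m = 0) :
    ∃ i ∈ l, ∀ m : M, a i • m = 0 := by
  classical
  have := IsSimpleModule.nontrivial (MonoidAlgebra K G) M
  induction l with
  | nil =>
    obtain ⟨m, hm⟩ := exists_ne (0 : M)
    exact absurd (by simpa using h (fun _ => 1) m) hm
  | cons i l ih =>
    rw [List.nodup_cons] at hl
    by_cases hi : ∀ m : M, a i • m = 0
    · exact ⟨i, by simp, hi⟩
    · obtain ⟨j, hj, hj'⟩ := ih hl.2 fun y => by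
        refine (annihilates_or_annihilates (a := a i) fun z m => ?_).resolve_left hi
        -- Since `i` does not recur in `l`, its conjugator `z` varies freely. Multiplying on the
        -- left by `z` leaves `a i * z * (rest)`, the form required by primeness.
        have := h (Function.update y i z) m
        rw [List.map_cons, List.prod_cons, List.map_congr_left
          (g := fun k => conjAlg (a k) (y k)) (fun k hk => by
            rw [Function.update_of_ne (fun hki => hl.1 (by rwa [← hki]))]),
          Function.update_self, conjAlg] at this
        have h2 := congrArg (fun v : M => MonoidAlgebra.of K G z • v) this
        simpa only [smul_zero, smul_smul, ← mul_assoc, ← map_mul, mul_inv_cancel, map_one,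
          one_mul] using h2
      exact ⟨j, by simp [hj], hj'⟩

/-- All values of `u` in `K[G]` annihilate the module `M`. -/
def Annihilates (G M : Type*) [Group G] [AddCommGroup M] [Module (MonoidAlgebra K G) M]
    (u : MonoidAlgebra K F) : Prop :=
  ∀ (g : ℕ → G) (m : M), subst g u • m = 0

/-- The three identities of the dihedral group of order `8` hold in the module `M`. -/
structure SatisfiesBasis (K : Type*) [Field K] (l : List (Fin 9 × Fin 9)) (G M : Type*) [Group G]
    [AddCommGroup M] [Module (MonoidAlgebra K G) M] : Prop where
  omega : Annihilates G M (omegaStar K l)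
  exp : Annihilates G M (expStar K)
  three : Annihilates G M (threeStar K)

theorem subst_of (g : ℕ → G) (w : F) :
    subst g (MonoidAlgebra.of K F w) = MonoidAlgebra.of K G (FreeGroup.lift g w) := by
  simp [subst]

theorem subst_mul (g : ℕ → G) (u v : MonoidAlgebra K F) :
    subst g (u * v) = subst g u * subst g v := map_mul _ _ _

theorem subst_minusOne (g : ℕ → G) (w : F) :
    subst g (minusOne K w) = MonoidAlgebra.of K G (FreeGroup.lift g w) - 1 := by
  rw [minusOne, ← subst_of]
  exact (map_sub _ _ _).trans (congrArg _ (map_one _))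

theorem subst_minusOne_conjBy (g : ℕ → G) (w : F) (n : ℕ) :
    subst g (minusOne K (conjBy w (X n))) =
      conjAlg (MonoidAlgebra.of K G (FreeGroup.lift g w) - 1) (g n) := by
  rw [subst_minusOne, conjAlg, mul_sub, sub_mul, mul_one, ← map_mul, ← map_mul, ← map_mul,
    inv_mul_cancel, map_one]
  simp [conjBy]

theorem subst_omegaStar (g : ℕ → G) (l : List (Fin 9 × Fin 9)) :
    subst g (omegaStar K l) = (l.map fun p =>
      conjAlg (MonoidAlgebra.of K G (g p.1 * (g p.2)⁻¹) - 1)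
        (g (9 + 9 * (p.1 : ℕ) + (p.2 : ℕ)))).prod := by
  rw [omegaStar, subst, map_list_prod, List.map_map]
  congr 1
  refine List.map_congr_left fun p _ => ?_
  refine (subst_minusOne_conjBy g _ _).trans ?_
  simp

theorem subst_expStar (g : ℕ → G) :
    subst g (expStar K) = MonoidAlgebra.of K G (g 0 ^ 4) - 1 := by
  rw [expStar, subst_minusOne]; simp

/-- The group elements whose conjugates occur in `threeStar`. -/
def threeBase (x y z : G) : Fin 6 → G :=
  ![x ^ 2, y ^ 2, z ^ 2, x * y⁻¹, x * z⁻¹, y * z⁻¹]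

theorem subst_threeStar (g : ℕ → G) :
    subst g (threeStar K) = ((List.finRange 6).map fun i =>
      conjAlg (MonoidAlgebra.of K G (threeBase (g 1) (g 2) (g 3) i) - 1)
        (g (4 + (i : ℕ)))).prod := by
  simp only [threeStar, subst_mul, subst_minusOne_conjBy]
  simp [List.finRange_succ, threeBase, mul_assoc]

end Module

/-! ### Groups acting on simple modules -/

section Simple

variable {K : Type*} [Field K] {G : Type*} [Group G]

/-- The subgroup of the elements of `G` which act trivially on a `K[G]`-module. -/
noncomputable def actionKernel (K G M : Type*) [Field K] [Group G] [AddCommGroup M]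
    [Module (MonoidAlgebra K G) M] : Subgroup G :=
  ((Module.toAddMonoidEnd (MonoidAlgebra K G) M).toMonoidHom.comp (MonoidAlgebra.of K G)).ker

variable {M : Type*} [AddCommGroup M] [Module (MonoidAlgebra K G) M]

instance : (actionKernel K G M).Normal := by
  unfold actionKernel; infer_instance

theorem mem_actionKernel {g : G} :
    g ∈ actionKernel K G M ↔ ∀ m : M, MonoidAlgebra.of K G g • m = m := by
  rw [actionKernel, MonoidHom.mem_ker, DFunLike.ext_iff]
  rfl

theorem mem_actionKernel_of_sub_one {g : G}
    (h : ∀ m : M, (MonoidAlgebra.of K G g - 1) • m = 0) : g ∈ actionKernel K G M :=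
  mem_actionKernel.2 fun m => by
    have := h m
    rwa [sub_smul, one_smul, sub_eq_zero] at this

theorem div_mem_actionKernel_iff {g h : G} :
    g * h⁻¹ ∈ actionKernel K G M ↔ (g : G ⧸ actionKernel K G M) = h := by
  rw [← QuotientGroup.eq_one_iff, QuotientGroup.mk_mul, QuotientGroup.mk_inv, mul_inv_eq_one]

theorem pow_four_eq_one_of_expStar (h : Annihilates G M (expStar K))
    (q : G ⧸ actionKernel K G M) : q ^ 4 = 1 := by
  obtain ⟨x, rfl⟩ := QuotientGroup.mk_surjective q
  rw [← QuotientGroup.mk_pow, QuotientGroup.eq_one_iff]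
  exact mem_actionKernel_of_sub_one fun m => by simpa [subst_expStar] using h (fun _ => x) m

variable [IsSimpleModule (MonoidAlgebra K G) M]

/-- Primeness singles out one factor, whose `x i * (x j)⁻¹` acts trivially. Thus the acting quotient
has at most eight elements. -/
theorem exists_lt_eq_of_omegaStar {l : List (Fin 9 × Fin 9)} (hl : l.Nodup)
    (hmem : ∀ p : Fin 9 × Fin 9, p ∈ l ↔ p.1 < p.2) (h : Annihilates G M (omegaStar K l))
    (q : Fin 9 → G ⧸ actionKernel K G M) : ∃ i j, i < j ∧ q i = q j := by
  choose x hx using fun i => QuotientGroup.mk_surjective (q i)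
  obtain ⟨p, hp, hp'⟩ := exists_annihilates_of_prod_conj (M := M)
    (fun p : Fin 9 × Fin 9 => MonoidAlgebra.of K G (x p.1 * (x p.2)⁻¹) - 1) l hl fun y m => by
      -- Letters from 9 on encode the pairs: quotient and remainder of `n - 9` by 9 recover `(i,
      -- j)`.
      have := h (fun n => if hn : n < 9 then x ⟨n, hn⟩ else
        y (Fin.ofNat 9 ((n - 9) / 9), Fin.ofNat 9 ((n - 9) % 9))) m
      rw [subst_omegaStar] at this
      convert this using 4 with p
      ext p : 1
      have h1 : ∀ i j : Fin 9, ¬ (9 + 9 * (i : ℕ) + (j : ℕ) < 9) := fun i j => by omega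
      have h2 : ∀ i j : Fin 9, (9 + 9 * (i : ℕ) + (j : ℕ) - 9) / 9 = i := fun i j => by omega
      have h3 : ∀ i j : Fin 9, (9 + 9 * (i : ℕ) + (j : ℕ) - 9) % 9 = j := fun i j => by omega
      simp [h1, h2, h3]
  refine ⟨p.1, p.2, (hmem p).1 hp, ?_⟩
  rw [← hx, ← hx, ← div_mem_actionKernel_iff]
  exact mem_actionKernel_of_sub_one hp'

theorem sq_eq_one_or_eq_of_threeStar (h : Annihilates G M (threeStar K))
    (a b c : G ⧸ actionKernel K G M) :
    a ^ 2 = 1 ∨ b ^ 2 = 1 ∨ c ^ 2 = 1 ∨ a = b ∨ a = c ∨ b = c := by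
  obtain ⟨x, rfl⟩ := QuotientGroup.mk_surjective a
  obtain ⟨y, rfl⟩ := QuotientGroup.mk_surjective b
  obtain ⟨z, rfl⟩ := QuotientGroup.mk_surjective c
  obtain ⟨i, -, hi⟩ := exists_annihilates_of_prod_conj (M := M)
    (fun i => MonoidAlgebra.of K G (threeBase x y z i) - 1) (List.finRange 6)
    (List.nodup_finRange 6) fun t m => by
      have := h (fun n => if n = 1 then x else if n = 2 then y else if n = 3 then z else
        t (Fin.ofNat 6 (n - 4))) m
      rw [subst_threeStar] at this
      convert this using 4
      ext i : 1
      have h1 : 4 + (i : ℕ) ≠ 1 := by omega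
      have h2 : 4 + (i : ℕ) ≠ 2 := by omega
      have h3 : 4 + (i : ℕ) ≠ 3 := by omega
      simp [h1, h2, h3]
  replace hi := mem_actionKernel_of_sub_one hi
  simp only [← QuotientGroup.mk_pow, QuotientGroup.eq_one_iff, ← div_mem_actionKernel_iff]
  fin_cases i
  · exact Or.inl hi
  · exact Or.inr (Or.inl hi)
  · exact Or.inr (Or.inr (Or.inl hi))
  · exact Or.inr (Or.inr (Or.inr (Or.inl hi)))
  · exact Or.inr (Or.inr (Or.inr (Or.inr (Or.inl hi))))
  · exact Or.inr (Or.inr (Or.inr (Or.inr (Or.inr hi))))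

/-- A central involution acts on a simple module as `-1`. -/
theorem smul_eq_neg_of_central_involution {x : G}
    (hx : (x : G ⧸ actionKernel K G M) ∈ Subgroup.center (G ⧸ actionKernel K G M))
    (hx2 : (x : G ⧸ actionKernel K G M) ^ 2 = 1) (hx1 : (x : G ⧸ actionKernel K G M) ≠ 1)
    (m : M) : MonoidAlgebra.of K G x • m = -m := by
  have h2 : ∀ m : M, MonoidAlgebra.of K G x • MonoidAlgebra.of K G x • m = m := fun m => by
    rw [← QuotientGroup.mk_pow, QuotientGroup.eq_one_iff, mem_actionKernel] at hx2
    rw [smul_smul, ← map_mul, ← pow_two, hx2]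
  have hcomm : ∀ (y : G) (m : M), MonoidAlgebra.of K G x • MonoidAlgebra.of K G y • m =
      MonoidAlgebra.of K G y • MonoidAlgebra.of K G x • m := fun y m => by
    have h := (Subgroup.mem_center_iff.1 hx y).symm
    rw [← QuotientGroup.mk_mul, ← QuotientGroup.mk_mul, QuotientGroup.eq] at h
    have h' := mem_actionKernel.1 h m
    rw [smul_smul, smul_smul, ← map_mul, ← map_mul]
    nth_rw 1 [show y * x = x * y * ((x * y)⁻¹ * (y * x)) by group]
    rw [map_mul _ (x * y), mul_smul, h']
  -- By centrality `(x - 1) y (x + 1)` acts as `y (x² - 1) = 0`, and primeness applies.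
  rcases annihilates_or_annihilates (M := M) (a := MonoidAlgebra.of K G x - 1)
    (b := MonoidAlgebra.of K G x + 1) fun y m => by
      simp only [mul_smul, sub_smul, add_smul, one_smul, smul_add, hcomm, h2]
      abel with h | h
  · exact absurd ((QuotientGroup.eq_one_iff x).2 (mem_actionKernel_of_sub_one h)) hx1
  · have := h m
    rwa [add_smul, one_smul, add_eq_zero_iff_eq_neg] at this

/-- Both elements act as -1, and the quotient acts faithfully. -/
theorem central_involution_unique (x : G ⧸ actionKernel K G M) (hx : x ∈ Subgroup.center _)
    (y : G ⧸ actionKernel K G M) (hy : y ∈ Subgroup.center _) (hx2 : x ^ 2 = 1) (hy2 : y ^ 2 = 1)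
    (hx1 : x ≠ 1) (hy1 : y ≠ 1) : x = y := by
  obtain ⟨x, rfl⟩ := QuotientGroup.mk_surjective x
  obtain ⟨y, rfl⟩ := QuotientGroup.mk_surjective y
  rw [QuotientGroup.eq, mem_actionKernel]
  intro m
  rw [map_mul, mul_smul, smul_eq_neg_of_central_involution hy hy2 hy1,
    ← smul_eq_neg_of_central_involution hx hx2 hx1, smul_smul, ← map_mul, inv_mul_cancel, map_one,
    one_smul]

/-- The group acting on a simple module in which the three identities hold is, up to the kernel
of the action, a subgroup of the dihedral group of order `8`. -/
theorem exists_hom_dihedralGroup {l : List (Fin 9 × Fin 9)} (hl : l.Nodup)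
    (hmem : ∀ p : Fin 9 × Fin 9, p ∈ l ↔ p.1 < p.2) (h : SatisfiesBasis K l G M) :
    ∃ f : G →* DihedralGroup 4, ∀ g, f g = 1 → ∀ m : M, MonoidAlgebra.of K G g • m = m := by
  obtain ⟨e, he⟩ := exists_injective_dihedralGroup (exists_lt_eq_of_omegaStar hl hmem h.omega)
    (pow_four_eq_one_of_expStar h.exp) (sq_eq_one_or_eq_of_threeStar h.three)
    central_involution_unique
  refine ⟨e.comp (QuotientGroup.mk' _), fun g hg => ?_⟩
  have : (g : G ⧸ actionKernel K G M) = 1 := he (by simpa using hg)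
  exact mem_actionKernel.1 ((QuotientGroup.eq_one_iff g).1 this)

theorem subst_comp {H : Type*} [Group H] (f : G →* H) (g : ℕ → G) (u : MonoidAlgebra K F) :
    MonoidAlgebra.mapDomainAlgHom K K f (subst g u) = subst (fun n => f (g n)) u := by
  rw [subst, subst, ← AlgHom.comp_apply, ← MonoidAlgebra.mapDomainAlgHom_comp]
  congr 2
  ext n
  simp

/-- The identities of the regular representation are the elements with trivial values in the
group algebra. -/
theorem isIdentity_leftRegular_iff {H : Type*} [Group H] {u : MonoidAlgebra K F} :
    IsIdentity (Representation.leftRegular K H) u ↔ ∀ g : ℕ → H, subst g u = 0 := by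
  have key : ∀ r v : MonoidAlgebra K H,
      (Representation.leftRegular K H).asAlgebraHom r v = r * v := fun r v =>
    (Representation.ofMulActionSelfAsModuleEquiv (k := K) (G := H)).map_smul r v
  refine ⟨fun h g => ?_, fun h g v => ?_⟩
  · simpa [key] using h g (1 : MonoidAlgebra K H)
  · rw [h g, map_zero, LinearMap.zero_apply]

/-- The identities of the regular representation of the dihedral group of order `8` hold in the
simple modules in which the three identities hold. -/
theorem annihilates_of_isSimpleModule {l : List (Fin 9 × Fin 9)} (hl : l.Nodup)
    (hmem : ∀ p : Fin 9 × Fin 9, p ∈ l ↔ p.1 < p.2) (h : SatisfiesBasis K l G M)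
    {u : MonoidAlgebra K F} (hu : IsIdentity (Representation.leftRegular K (DihedralGroup 4)) u) :
    Annihilates G M u := by
  obtain ⟨f, hf⟩ := exists_hom_dihedralGroup hl hmem h
  refine fun g m => smul_eq_zero_of_mapDomain_eq_zero f hf ?_ m
  rw [subst_comp, isIdentity_leftRegular_iff.1 hu]

end Simple

/-! ### From simple modules to arbitrary representations -/

section General

variable {K : Type*} [Field K] {G : Type*} [Group G]

/-- The annihilator is two-sided: a value of `u` times any `r` still kills `V`, hence lies in the
left ideal `m`. -/
theorem Annihilates.quotient {V : Type*} [AddCommGroup V] [Module (MonoidAlgebra K G) V]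
    {u : MonoidAlgebra K F} (h : Annihilates G V u) {m : Ideal (MonoidAlgebra K G)}
    (hm : Module.annihilator (MonoidAlgebra K G) V ≤ m) :
    Annihilates G (MonoidAlgebra K G ⧸ m) u := by
  intro g x
  obtain ⟨r, rfl⟩ := Submodule.Quotient.mk_surjective m x
  rw [← Submodule.Quotient.mk_smul, Submodule.Quotient.mk_eq_zero]
  apply hm
  rw [Module.mem_annihilator]
  intro v
  rw [smul_eq_mul, mul_smul]
  exact h g _

/-- If the three identities hold in a module, then every group element in the kernel of all
homomorphisms to the dihedral group of order `8` acts trivially on it. -/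
theorem smul_eq_of_forall_hom_eq_one (hK : (2 : K) ≠ 0) {l : List (Fin 9 × Fin 9)}
    (hl : l.Nodup) (hmem : ∀ p : Fin 9 × Fin 9, p ∈ l ↔ p.1 < p.2)
    {V : Type*} [AddCommGroup V] [Module (MonoidAlgebra K G) V] (h : SatisfiesBasis K l G V)
    {n : G} (hn : ∀ f : G →* DihedralGroup 4, f n = 1) (v : V) :
    MonoidAlgebra.of K G n • v = v := by
  set t := MonoidAlgebra.of K G n
  -- Since `a * (t - 1) = t ^ 4 - 1` kills `V`, it is enough that `a` acts injectively.
  set a := t ^ 3 + t ^ 2 + t + 1 with ha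
  by_cases htop : Module.annihilator (MonoidAlgebra K G) V ⊔ Ideal.span {a} = ⊤
  · have h1 : (1 : MonoidAlgebra K G) ∈
        Module.annihilator (MonoidAlgebra K G) V ⊔ Ideal.span {a} := htop ▸ Submodule.mem_top
    obtain ⟨c, hc, d, hd, hcd⟩ := Submodule.mem_sup.1 h1
    obtain ⟨b, rfl⟩ := Ideal.mem_span_singleton'.1 hd
    have h4 : (t ^ 4 - 1) • v = 0 := by
      have := h.exp (fun _ => n) v
      rwa [subst_expStar, map_pow] at this
    have hat : a * (t - 1) = t ^ 4 - 1 := by rw [ha]; noncomm_ring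
    have key : ∀ x : V, a • x = 0 → x = 0 := fun x hx => by
      rw [← one_smul (MonoidAlgebra K G) x, ← hcd, add_smul, Module.mem_annihilator.1 hc, zero_add, mul_smul, hx, smul_zero]
    have := key ((t - 1) • v) (by rw [smul_smul, hat, h4])
    rwa [sub_smul, one_smul, sub_eq_zero] at this
  -- Otherwise a maximal left ideal `m` contains `a` and the annihilator. On the simple quotient `t`
  -- acts as 1, so `a` acts as 4, which is invertible; yet `a` kills the class of 1.
  · exfalso
    obtain ⟨m, hm, hle⟩ := Ideal.exists_le_maximal _ htop
    have hann := le_sup_left.trans hle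
    have ham : a ∈ m := hle (Ideal.mem_sup_right (Ideal.mem_span_singleton_self a))
    have : IsSimpleModule (MonoidAlgebra K G) (MonoidAlgebra K G ⧸ m) :=
      isSimpleModule_iff_isCoatom.2 hm.out
    obtain ⟨f, hf⟩ := exists_hom_dihedralGroup (M := MonoidAlgebra K G ⧸ m) hl hmem
      ⟨h.omega.quotient hann, h.exp.quotient hann, h.three.quotient hann⟩
    have ht1 : ∀ x : MonoidAlgebra K G ⧸ m, t • x = x := hf n (hn f)
    have h4 : (4 : K) ≠ 0 := by
      rw [show (4 : K) = 2 * 2 by norm_num]; exact mul_ne_zero hK hK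
    let e : MonoidAlgebra K G ⧸ m := Submodule.Quotient.mk 1
    have hae : a • e = 0 := by
      rw [← Submodule.Quotient.mk_smul, Submodule.Quotient.mk_eq_zero, smul_eq_mul, mul_one]
      exact ham
    have hae' : a • e = algebraMap K (MonoidAlgebra K G) 4 • e := by
      have : (algebraMap K (MonoidAlgebra K G) 4) = 1 + 1 + 1 + 1 := by
        rw [show (4 : K) = 1 + 1 + 1 + 1 by norm_num, map_add, map_add, map_add, map_one]
      rw [this, ha]
      simp only [pow_succ, pow_zero, one_mul, add_smul, mul_smul, ht1, one_smul]
    have he : e = 0 := by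
      rw [← one_smul (MonoidAlgebra K G) e, ← map_one (algebraMap K (MonoidAlgebra K G)),
        ← inv_mul_cancel₀ h4, map_mul, mul_smul, ← hae', hae, smul_zero]
    exact hm.ne_top ((Ideal.eq_top_iff_one m).2 ((Submodule.Quotient.mk_eq_zero m).1 he))

/-- The identities of the regular representation of the dihedral group of order `8` hold in the
modules over a semisimple group algebra in which the three identities hold. -/
theorem annihilates_of_finite [Finite G] (hG : (Nat.card G : K) ≠ 0)
    {l : List (Fin 9 × Fin 9)} (hl : l.Nodup) (hmem : ∀ p : Fin 9 × Fin 9, p ∈ l ↔ p.1 < p.2)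
    {V : Type*} [AddCommGroup V] [Module (MonoidAlgebra K G) V] (h : SatisfiesBasis K l G V)
    {u : MonoidAlgebra K F} (hu : IsIdentity (Representation.leftRegular K (DihedralGroup 4)) u) :
    Annihilates G V u := by
  have : NeZero (Nat.card G : K) := ⟨hG⟩
  have hsub : ∀ (S : Submodule (MonoidAlgebra K G) V) {w : MonoidAlgebra K F},
      Annihilates G V w → Annihilates G S w := fun S w hw g m => Subtype.ext (hw g m)
  intro g v
  -- By Maschke's theorem `V` is the sum of its simple submodules.
  have hv : v ∈ sSup {S : Submodule (MonoidAlgebra K G) V |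
      IsSimpleModule (MonoidAlgebra K G) S} := by
    rw [IsSemisimpleModule.sSup_simples_eq_top]; exact Submodule.mem_top
  rw [sSup_eq_iSup'] at hv
  induction hv using Submodule.iSup_induction' with
  | mem S x hx =>
    have : IsSimpleModule (MonoidAlgebra K G) S.1 := S.2
    exact congrArg Subtype.val (annihilates_of_isSimpleModule (M := S.1) hl hmem
      ⟨hsub _ h.omega, hsub _ h.exp, hsub _ h.three⟩ hu g ⟨x, hx⟩)
  | zero => exact smul_zero _
  | add x y _ _ hx hy => rw [smul_add, hx, hy, add_zero]

variable {V : Type*} [AddCommGroup V] [Module K V]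

theorem isIdentity_iff_annihilates {ρ : Representation K G V} {u : MonoidAlgebra K F} :
    IsIdentity ρ u ↔ Annihilates G ρ.asModule u :=
  Iff.rfl

theorem asAlgebraHom_comp {H : Type*} [Group H] (ρ : Representation K H V) (f : G →* H)
    (w : MonoidAlgebra K G) :
    Representation.asAlgebraHom (MonoidHom.comp ρ f : Representation K G V) w =
      ρ.asAlgebraHom (MonoidAlgebra.mapDomainAlgHom K K f w) := by
  rw [← AlgHom.comp_apply]
  congr 1
  ext g : 2
  simp

theorem IsIdentity.comp {H : Type*} [Group H] {ρ : Representation K H V} {u : MonoidAlgebra K F}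
    (h : IsIdentity ρ u) (f : G →* H) :
    IsIdentity (MonoidHom.comp ρ f : Representation K G V) u := fun g v => by
  rw [asAlgebraHom_comp, subst_comp, h]

theorem IsIdentity.of_comp {H : Type*} [Group H] {ρ : Representation K H V}
    {u : MonoidAlgebra K F} {f : G →* H} (hf : Function.Surjective f)
    (h : IsIdentity (MonoidHom.comp ρ f : Representation K G V) u) : IsIdentity ρ u := fun g v => by
  choose x hx using fun n => hf (g n)
  rw [← h x v, asAlgebraHom_comp, subst_comp]
  simp only [hx]

/-- A word only involves finitely many letters. -/
theorem exists_forall_lift_eq (w : F) : ∃ n : ℕ, ∀ N, n ≤ N → ∀ g g' : ℕ → G,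
    (∀ i < N, g i = g' i) → FreeGroup.lift g w = FreeGroup.lift g' w := by
  induction w using FreeGroup.induction_on with
  | C1 => exact ⟨0, fun _ _ g g' _ => by rw [map_one, map_one]⟩
  | of i => exact ⟨i + 1, fun N hN g g' h => by simpa using h i hN⟩
  | inv_of i ih =>
    obtain ⟨n, hn⟩ := ih
    exact ⟨n, fun N hN g g' h => by rw [map_inv, map_inv, hn N hN g g' h]⟩
  | mul x y hx hy =>
    obtain ⟨n, hn⟩ := hx
    obtain ⟨k, hk⟩ := hy
    exact ⟨max n k, fun N hN g g' h => by
      rw [map_mul, map_mul, hn N ((le_max_left _ _).trans hN) g g' h,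
        hk N ((le_max_right _ _).trans hN) g g' h]⟩

/-- An element of `KF` only involves finitely many letters. -/
theorem exists_forall_subst_eq (u : MonoidAlgebra K F) : ∃ n : ℕ, ∀ N, n ≤ N → ∀ g g' : ℕ → G,
    (∀ i < N, g i = g' i) → subst g u = subst g' u := by
  induction u using MonoidAlgebra.induction_on with
  | of w =>
    obtain ⟨n, hn⟩ := exists_forall_lift_eq (G := G) w
    exact ⟨n, fun N hN g g' h => by rw [subst_of, subst_of, hn N hN g g' h]⟩
  | add x y hx hy =>
    obtain ⟨n, hn⟩ := hx
    obtain ⟨k, hk⟩ := hy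
    refine ⟨max n k, fun N hN g g' h => ?_⟩
    have h1 := hn N ((le_max_left _ _).trans hN) g g' h
    have h2 := hk N ((le_max_right _ _).trans hN) g g' h
    simp only [subst] at h1 h2 ⊢
    rw [map_add, map_add, h1, h2]
  | smul c x hx =>
    obtain ⟨n, hn⟩ := hx
    refine ⟨n, fun N hN g g' h => ?_⟩
    have h1 := hn N hN g g' h
    simp only [subst] at h1 ⊢
    rw [map_smul, map_smul, h1]

/-- The identities of the regular representation of the dihedral group of order `8` hold in the
representations of finitely generated free groups in which the three identities hold. -/
theorem isIdentity_of_freeGroup (hK : (2 : K) ≠ 0) {l : List (Fin 9 × Fin 9)}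
    (hl : l.Nodup) (hmem : ∀ p : Fin 9 × Fin 9, p ∈ l ↔ p.1 < p.2) {n : ℕ}
    {ρ : Representation K (FreeGroup (Fin n)) V}
    (h : InVarietyDefinedBy {omegaStar K l, expStar K, threeStar K} ρ)
    {u : MonoidAlgebra K F} (hu : IsIdentity (Representation.leftRegular K (DihedralGroup 4)) u) :
    IsIdentity ρ u := by
  have : Finite (FreeGroup (Fin n) →* DihedralGroup 4) := Finite.of_equiv _ FreeGroup.lift
  let Φ : FreeGroup (Fin n) →* ((FreeGroup (Fin n) →* DihedralGroup 4) → DihedralGroup 4) :=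
    MonoidHom.pi fun f => f
  have hΦ : ∀ x ∈ Φ.ker, ρ x = 1 := fun x hx => by
    ext v
    have h1 := smul_eq_of_forall_hom_eq_one (V := ρ.asModule) hK hl hmem
      ⟨h _ (by simp), h _ (by simp), h _ (by simp)⟩ (n := x)
      (fun f => congrFun (MonoidHom.mem_ker.1 hx) f) v
    rw [← Representation.asAlgebraHom_of ρ x]
    exact h1
  let Q := FreeGroup (Fin n) ⧸ Φ.ker
  let τ : Representation K Q V := QuotientGroup.lift Φ.ker ρ hΦ
  have hτ : ρ = MonoidHom.comp τ (QuotientGroup.mk' Φ.ker) := by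
    ext x : 1
    rfl
  -- `Q` embeds in a finite power of D₈, whose order is a power of 8 = 2³.
  have hdvd : Nat.card Q ∣ 2 ^ (3 * Nat.card (FreeGroup (Fin n) →* DihedralGroup 4)) := by
    rw [pow_mul, Nat.card_congr (QuotientGroup.quotientKerEquivRange Φ).toEquiv]
    have := Subgroup.card_subgroup_dvd_card Φ.range
    rwa [Nat.card_fun, DihedralGroup.nat_card] at this
  have hQ : (Nat.card Q : K) ≠ 0 := by
    obtain ⟨k, -, hk⟩ := (Nat.dvd_prime_pow Nat.prime_two).1 hdvd
    rw [hk, Nat.cast_pow]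
    exact pow_ne_zero _ (by exact_mod_cast hK)
  have : Finite Q := Finite.of_equiv _ (QuotientGroup.quotientKerEquivRange Φ).symm.toEquiv
  have hsurj : Function.Surjective (QuotientGroup.mk' Φ.ker) := QuotientGroup.mk'_surjective _
  rw [hτ] at h ⊢
  refine IsIdentity.comp (isIdentity_iff_annihilates.2 (annihilates_of_finite hQ hl hmem
    ⟨?_, ?_, ?_⟩ hu)) _
  · exact IsIdentity.of_comp hsurj (h _ (by simp))
  · exact IsIdentity.of_comp hsurj (h _ (by simp))
  · exact IsIdentity.of_comp hsurj (h _ (by simp))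

/-- The identities of the regular representation of the dihedral group of order `8` hold in all
representations in which the three identities hold. -/
theorem isIdentity_of_inVariety (hK : (2 : K) ≠ 0) {l : List (Fin 9 × Fin 9)}
    (hl : l.Nodup) (hmem : ∀ p : Fin 9 × Fin 9, p ∈ l ↔ p.1 < p.2) {ρ : Representation K G V}
    (h : InVarietyDefinedBy {omegaStar K l, expStar K, threeStar K} ρ)
    {u : MonoidAlgebra K F} (hu : IsIdentity (Representation.leftRegular K (DihedralGroup 4)) u) :
    IsIdentity ρ u := by
  intro g v
  obtain ⟨n, hn⟩ := exists_forall_subst_eq (G := G) u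
  let f : FreeGroup (Fin n) →* G := FreeGroup.lift fun i => g i
  -- Letters from `n` on do not affect the value of `u`, so they may go to 1.
  let x : ℕ → FreeGroup (Fin n) := fun i => if hi : i < n then FreeGroup.of ⟨i, hi⟩ else 1
  have hx : ∀ i < n, g i = f (x i) := fun i hi => by simp [f, x, hi]
  rw [hn n le_rfl g _ hx, ← subst_comp, ← asAlgebraHom_comp]
  exact isIdentity_of_freeGroup hK hl hmem (fun w hw => (h w hw).comp f) hu x v

end General

/-! ### The three identities hold for D₈ -/

section Dihedral

variable {K : Type*} [Field K] {G : Type*} [Group G]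

theorem prod_conjAlg_eq_zero {ι : Type*} (a y : ι → G) (l : List ι) (h : ∃ i ∈ l, a i = 1) :
    (l.map fun i => conjAlg (MonoidAlgebra.of K G (a i) - 1) (y i)).prod = 0 := by
  obtain ⟨i, hi, hai⟩ := h
  exact List.prod_eq_zero (List.mem_map.2 ⟨i, hi, by rw [hai, map_one, sub_self, conjAlg]; simp⟩)

theorem basis_subset_identitiesOf {l : List (Fin 9 × Fin 9)}
    (hmem : ∀ p : Fin 9 × Fin 9, p ∈ l ↔ p.1 < p.2) :
    {omegaStar K l, expStar K, threeStar K} ⊆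
      identitiesOf (Representation.leftRegular K (DihedralGroup 4)) := by
  rintro u (rfl | rfl | rfl) <;> refine isIdentity_leftRegular_iff.2 fun g => ?_
  · rw [subst_omegaStar]
    obtain ⟨i, j, hij, h⟩ := Fintype.exists_ne_map_eq_of_card_lt
      (fun i : Fin 9 => g i) (by rw [DihedralGroup.card, Fintype.card_fin]; norm_num)
    refine prod_conjAlg_eq_zero (fun p : Fin 9 × Fin 9 => g p.1 * (g p.2)⁻¹) _ l ?_
    rcases lt_or_gt_of_ne hij with hlt | hlt
    · exact ⟨(i, j), (hmem _).2 hlt, mul_inv_eq_one.2 h⟩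
    · exact ⟨(j, i), (hmem _).2 hlt, mul_inv_eq_one.2 h.symm⟩
  · have : ∀ x : DihedralGroup 4, x ^ 4 = 1 := by decide
    rw [subst_expStar, this, map_one, sub_self]
  · rw [subst_threeStar]
    refine prod_conjAlg_eq_zero (threeBase (g 1) (g 2) (g 3)) _ _ ?_
    -- Only two elements have nontrivial square, so among three such elements two coincide.
    have hsq : ∀ x : DihedralGroup 4,
        x ^ 2 = 1 ∨ x = DihedralGroup.r 1 ∨ x = DihedralGroup.r 3 := by decide
    have : ∀ x y z : DihedralGroup 4,
        x ^ 2 = 1 ∨ y ^ 2 = 1 ∨ z ^ 2 = 1 ∨ x = y ∨ x = z ∨ y = z := by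
      intro x y z
      rcases hsq x with hx | rfl | rfl <;> rcases hsq y with hy | rfl | rfl <;>
        rcases hsq z with hz | rfl | rfl <;> simp_all
    rcases this (g 1) (g 2) (g 3) with h | h | h | h | h | h
    · exact ⟨0, List.mem_finRange _, h⟩
    · exact ⟨1, List.mem_finRange _, h⟩
    · exact ⟨2, List.mem_finRange _, h⟩
    · exact ⟨3, List.mem_finRange _, mul_inv_eq_one.2 h⟩
    · exact ⟨4, List.mem_finRange _, mul_inv_eq_one.2 h⟩
    · exact ⟨5, List.mem_finRange _, mul_inv_eq_one.2 h⟩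

end Dihedral

end RepIdentities

theorem proposition5 (K : Type uK) [Field K] (hK : ringChar K ≠ 2)
    (l : List (Fin 9 × Fin 9)) (hl : l.Nodup) (hmem : ∀ p : Fin 9 × Fin 9, p ∈ l ↔ p.1 < p.2) :
    RepIdentities.IsBasisOfIdentities.{uK, 0, uK, uG, uV}
      (Representation.leftRegular K (DihedralGroup 4))
      {RepIdentities.omegaStar K l, RepIdentities.expStar K, RepIdentities.threeStar K} := by
  refine ⟨RepIdentities.basis_subset_identitiesOf hmem, fun G V _ _ _ σ => ⟨fun h u hu => ?_,
    fun h u hu => h u (RepIdentities.basis_subset_identitiesOf hmem hu)⟩⟩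
  exact RepIdentities.isIdentity_of_inVariety (Ring.two_ne_zero hK) hl hmem h hu
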